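/- Let $M$ be an infinite metric space with a distinguished point $0 \in M$. Let $\mathrm{Lip}_0(M)$ be the Banach space of all Lipschitz functions $f : M \to \mathbb{R}$ with $f(0) = 0$, normed by the minimal Lipschitz constant $\|f\|_{\mathrm{Lip}} = \sup\{|f(x)-f(y)|/d(x,y) : x \neq y\}$. Let $\delta_x \in \mathrm{Lip}_0(M)^*$ be the evaluation functional $\delta_x(f) = f(x)$. Let $X = \mathcal{F}(M)$ be the Lipschitz-free space over $M$, that is, the closed linear span of $\{\delta_x : x \in M\}$ in $\mathrm{Lip}_0(M)^*$ with the dual norm. (All Banach spaces are real.) Then the following hold. 1. There is a complemented subspace of $X$ that is linearly isomorphic to $\ell_1$. 2. For every compact Hausdorff space $K$, $X$ is not linearly isomorphic to a complemented subspace of $C(K)$. 3. $X^*$ is not weakly sequentially complete: there is a weakly Cauchy sequence in $X^*$ that does not converge weakly. Moreover, $X$ is not linearly isomorphic to an $L^1$-predual, that is, to a Banach space $Z$ whose dual $Z^*$ is linearly isometric to $L^1(\mu)$ for some measure $\mu$. 4. $X$ is not linearly isomorphic to the Gurariĭ space. Here the Gurariĭ space is the separable Banach space $G$, unique up to linear isometry,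 with the following property: for every finite-dimensional normed space $F$, every subspace $E \subseteq F$, every linear isometric embedding $f : E \to G$ and every $\varepsilon > 0$, there is a linear map $g : F \to G$ extending $f$ such that $(1+\varepsilon)^{-1}\|x\| \le \|g(x)\| \le (1+\varepsilon)\|x\|$ for all $x \in F$. 5. For every separable Banach space $Y$ there is a bounded linear operator from $X$ onto $Y$. If in addition $M$ is separable, then $X$ is itself separable (so $X$ is a projectively universal separable Banach space). -/

import Mathlib

open Filter Topology MeasureTheory
open scoped NNReal

universe u v w

noncomputable section

/-! ## The Lipschitz-free space of a pointed metric space -/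

/-- The real vector space of Lipschitz functions on `M` vanishing at the base point `o`, as a
subspace of all functions `M → ℝ`. -/
def lipZeroSubmodule (M : Type u) [MetricSpace M] (o : M) : Submodule ℝ (M → ℝ) where
  carrier := {f | f o = 0 ∧ ∃ K : ℝ≥0, LipschitzWith K f}
  zero_mem' := ⟨rfl, 0, LipschitzWith.const 0⟩
  add_mem' := by
    rintro f g ⟨hf, K, hK⟩ ⟨hg, L, hL⟩
    exact ⟨by simp [hf, hg], K + L, hK.add hL⟩
  smul_mem' := by
    rintro c f ⟨hf, K, hK⟩
    refine ⟨by simp [hf], ‖c‖₊ * K, LipschitzWith.of_dist_le_mul fun x y => ?_⟩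
    have h := hK.dist_le_mul x y
    simp only [Pi.smul_apply, smul_eq_mul, Real.dist_eq, NNReal.coe_mul, coe_nnnorm,
      Real.norm_eq_abs, ← mul_sub, abs_mul, mul_assoc] at h ⊢
    exact mul_le_mul_of_nonneg_left h (abs_nonneg c)

/-- The space `Lip₀(M)`. A separate type, so that it does not inherit the topology of pointwise
convergence from `M → ℝ`; it is normed by the minimal Lipschitz constant below. -/
def LipZero (M : Type u) [MetricSpace M] (o : M) : Type u := lipZeroSubmodule M o

namespace LipZero

variable {M : Type u} [MetricSpace M] {o : M}

instance : AddCommGroup (LipZero M o) := inferInstanceAs (AddCommGroup (lipZeroSubmodule M o))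

instance : Module ℝ (LipZero M o) := inferInstanceAs (Module ℝ (lipZeroSubmodule M o))

instance : CoeFun (LipZero M o) (fun _ => M → ℝ) := ⟨fun f => f.1⟩

/-- The Lipschitz norm `sup {|f x - f y| / d(x, y) : x ≠ y}`. The pairs with `x = y` contribute
`0 / 0 = 0`, which does not change the supremum. -/
instance : Norm (LipZero M o) := ⟨fun f => ⨆ p : M × M, |f p.1 - f p.2| / dist p.1 p.2⟩

theorem norm_def (f : LipZero M o) : ‖f‖ = ⨆ p : M × M, |f p.1 - f p.2| / dist p.1 p.2 := rfl

theorem map_base (f : LipZero M o) : f o = 0 := f.2.1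

theorem bddAbove (f : LipZero M o) :
    BddAbove (Set.range fun p : M × M => |f p.1 - f p.2| / dist p.1 p.2) := by
  obtain ⟨K, hK⟩ := f.2.2
  refine ⟨K, ?_⟩
  rintro _ ⟨p, rfl⟩
  exact div_le_of_le_mul₀ dist_nonneg K.2 (hK.dist_le_mul p.1 p.2)

theorem norm_nonneg' (f : LipZero M o) : 0 ≤ ‖f‖ :=
  Real.iSup_nonneg fun _ => div_nonneg (abs_nonneg _) dist_nonneg

theorem abs_sub_le (f : LipZero M o) (x y : M) : |f x - f y| ≤ ‖f‖ * dist x y := by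
  rcases eq_or_ne x y with rfl | h
  · simp
  · exact (div_le_iff₀ (dist_pos.2 h)).1 (le_ciSup f.bddAbove (x, y))

theorem norm_le {f : LipZero M o} {C : ℝ} (hC : 0 ≤ C)
    (h : ∀ x y, |f x - f y| ≤ C * dist x y) : ‖f‖ ≤ C :=
  haveI : Nonempty M := ⟨o⟩
  ciSup_le fun p => div_le_of_le_mul₀ dist_nonneg hC (h p.1 p.2)

theorem norm_smul_le' (c : ℝ) (f : LipZero M o) : ‖c • f‖ ≤ |c| * ‖f‖ := by
  refine norm_le (mul_nonneg (abs_nonneg c) f.norm_nonneg') fun x y => ?_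
  have e : (c • f) x - (c • f) y = c * (f x - f y) := (mul_sub c (f x) (f y)).symm
  rw [e, abs_mul, mul_assoc]
  exact mul_le_mul_of_nonneg_left (f.abs_sub_le x y) (abs_nonneg c)

theorem core : NormedSpace.Core ℝ (LipZero M o) where
  norm_nonneg := norm_nonneg'
  norm_smul c f := by
    refine le_antisymm (norm_smul_le' c f) ?_
    rcases eq_or_ne c 0 with rfl | hc
    · simpa using norm_nonneg' ((0 : ℝ) • f)
    · have h := norm_smul_le' c⁻¹ (c • f)
      rw [smul_smul, inv_mul_cancel₀ hc, one_smul, abs_inv] at h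
      rw [Real.norm_eq_abs]
      exact (le_inv_mul_iff₀ (abs_pos.2 hc)).1 h
  norm_triangle f g := by
    refine norm_le (add_nonneg f.norm_nonneg' g.norm_nonneg') fun x y => ?_
    have e : (f + g) x - (f + g) y = (f x - f y) + (g x - g y) :=
      add_sub_add_comm (f x) (g x) (f y) (g y)
    rw [e, add_mul]
    exact (abs_add_le _ _).trans (add_le_add (f.abs_sub_le x y) (g.abs_sub_le x y))
  norm_eq_zero_iff f := by
    constructor
    · intro h
      refine Subtype.ext (funext fun x => ?_)
      have hx := f.abs_sub_le x o
      rw [h, zero_mul, f.map_base, sub_zero] at hx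
      exact abs_nonpos_iff.1 hx
    · rintro rfl
      refine le_antisymm (norm_le le_rfl fun x y => ?_) (norm_nonneg' _)
      have e : (0 : LipZero M o) x - (0 : LipZero M o) y = 0 := sub_self (0 : ℝ)
      rw [e]
      simp

instance : NormedAddCommGroup (LipZero M o) := NormedAddCommGroup.ofCore core

instance : NormedSpace ℝ (LipZero M o) := NormedSpace.ofCore core

/-- The evaluation functional `δ x : f ↦ f x` in the dual of `Lip₀(M)`. -/
def delta (o x : M) : StrongDual ℝ (LipZero M o) :=
  LinearMap.mkContinuous
    { toFun := fun f => f x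
      map_add' := fun _ _ => rfl
      map_smul' := fun _ _ => rfl } (dist x o) (fun f => by
        have h := f.abs_sub_le x o
        rw [f.map_base, sub_zero, mul_comm] at h
        exact h)

end LipZero

/-- The Lipschitz-free space `F(M)`: the closed linear span of the evaluation functionals in the
dual of `Lip₀(M)`, with the dual norm. -/
def lipFree (M : Type u) [MetricSpace M] (o : M) : Submodule ℝ (StrongDual ℝ (LipZero M o)) :=
  (Submodule.span ℝ (Set.range (LipZero.delta o))).topologicalClosure

/-- The Lipschitz-free space as a type; it carries the norm of the dual of `Lip₀(M)`. -/
def LipFree (M : Type u) [MetricSpace M] (o : M) : Type u := lipFree M o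

instance (M : Type u) [MetricSpace M] (o : M) : NormedAddCommGroup (LipFree M o) :=
  inferInstanceAs (NormedAddCommGroup (lipFree M o))

instance (M : Type u) [MetricSpace M] (o : M) : NormedSpace ℝ (LipFree M o) :=
  inferInstanceAs (NormedSpace ℝ (lipFree M o))

/-! ## Notions from Banach space theory -/

/-- The real Banach space `ℓ₁`. -/
abbrev EllOne : Type := lp (fun _ : ℕ => ℝ) 1

/-- `X` has a complemented subspace which is linearly isomorphic to `Y`
(`ClosedComplemented` means: the range of a bounded linear projection). -/
def HasComplementedCopy (X : Type u) [NormedAddCommGroup X] [NormedSpace ℝ X]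
    (Y : Type v) [NormedAddCommGroup Y] [NormedSpace ℝ Y] : Prop :=
  ∃ V : Submodule ℝ X, V.ClosedComplemented ∧ Nonempty (Y ≃L[ℝ] V)

/-- Every weakly Cauchy sequence converges weakly. -/
def IsWeaklySequentiallyComplete (X : Type u) [NormedAddCommGroup X] [NormedSpace ℝ X] : Prop :=
  ∀ x : ℕ → X, (∀ φ : StrongDual ℝ X, CauchySeq fun n => φ (x n)) →
    ∃ a : X, ∀ φ : StrongDual ℝ X, Tendsto (fun n => φ (x n)) atTop (𝓝 (φ a))

/-- The dual of `X` is linearly isometric to `L¹(μ)` for some measure `μ`. -/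
def IsLOnePredual (X : Type u) [NormedAddCommGroup X] [NormedSpace ℝ X] : Prop :=
  ∃ (Ω : Type w) (_ : MeasurableSpace Ω) (μ : Measure Ω),
    Nonempty (StrongDual ℝ X ≃ₗᵢ[ℝ] Lp ℝ 1 μ)

/-- `X` is (isometrically) the Gurariĭ space: a separable Banach space such that every isometric
embedding into `X` of a subspace `E` of a finite-dimensional space `F` extends, for each `ε > 0`,
to a linear `(1 + ε)`-isometric embedding of `F`. (Every finite-dimensional normed space is
isometric to one in the lowest universe.) -/
structure IsGurariiSpace (X : Type u) [NormedAddCommGroup X] [NormedSpace ℝ X] : Prop where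
  complete : CompleteSpace X
  separable : TopologicalSpace.SeparableSpace X
  extension : ∀ (F : Type) [NormedAddCommGroup F] [NormedSpace ℝ F] [FiniteDimensional ℝ F]
    (E : Submodule ℝ F) (f : E →ₗᵢ[ℝ] X) (ε : ℝ), 0 < ε →
    ∃ g : F →L[ℝ] X, (∀ x : E, g x = f x) ∧
      ∀ x : F, (1 + ε)⁻¹ * ‖x‖ ≤ ‖g x‖ ∧ ‖g x‖ ≤ (1 + ε) * ‖x‖

end

/-! Everything follows from one `EllOneSystem` in the free space: bounded vectors and biorthogonal
functionals whose signed sums are uniformly bounded. An infinite metric space contains disjoint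
balls, each with a point outside all the balls at distance comparable to its radius
(`DisjointBalls.nonempty`). The normalized molecules centre minus outer point are the vectors, and
tent functions on the balls are the functionals; at most two tents see a given pair of points,
whence the bound on signed sums.

Such a system makes `ℓ₁` a complemented subspace, so every separable Banach space is a quotient. The
partial sums of the functionals are weakly Cauchy without weak limit. Systems pass to any space in
which the given one is complemented, so the other claims reduce to showing that certain spaces carry
none.

The obstruction is Khinchine's inequality: in an `L¹` space, `n` vectors with norms bounded below
have average signed sum of order at least `√n`. This excludes an `L¹` dual at once. For `C(K)` and
the Gurariĭ space it is applied in `ℓ₁(κ)`, the dual of a finite `ℓ_∞(κ)` through which the first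
`n` vectors factor with uniform bounds (`EllOneSystem.not_factor_sup`). -/

noncomputable section

/-! ## Signed sums and a Khinchine inequality -/

/-- The signed sum `∑ ± a i` over `s`, with sign `+` on `t` and sign `-` off `t`. -/
def signedSum {ι E : Type*} [DecidableEq ι] [AddCommGroup E] (s t : Finset ι) (a : ι → E) : E :=
  ∑ i ∈ s, if i ∈ t then a i else -a i

theorem map_signedSum {ι E F G : Type*} [DecidableEq ι] [AddCommGroup E] [AddCommGroup F]
    [FunLike G E F] [AddMonoidHomClass G E F] (g : G) (s t : Finset ι) (a : ι → E) :
    g (signedSum s t a) = signedSum s t fun i => g (a i) := by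
  simp only [signedSum, map_sum]
  exact Finset.sum_congr rfl fun i _ => by split_ifs <;> simp

/-- Conditioning on the sign of `i`: the induction step for all moments of signed sums. -/
theorem sum_powerset_insert_signedSum {ι : Type*} [DecidableEq ι] {s : Finset ι} {i : ι}
    (hi : i ∉ s) (a : ι → ℝ) (F : ℝ → ℝ) :
    ∑ t ∈ (insert i s).powerset, F (signedSum (insert i s) t a) =
      ∑ t ∈ s.powerset, (F (signedSum s t a - a i) + F (signedSum s t a + a i)) := by
  rw [Finset.sum_powerset_insert hi, Finset.sum_add_distrib]
  congr 1 <;> refine Finset.sum_congr rfl fun t ht => ?_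
  · have h : i ∉ t := fun h => hi (Finset.mem_powerset.1 ht h)
    rw [signedSum, Finset.sum_insert hi, if_neg h, neg_add_eq_sub]
    rfl
  · rw [signedSum, Finset.sum_insert hi, if_pos (Finset.mem_insert_self i t), add_comm]
    congr 2
    refine Finset.sum_congr rfl fun j hj => ?_
    have : j ≠ i := fun h => hi (h ▸ hj)
    simp [this]

/-- Random signs are orthogonal: the cross terms cancel between `+a i` and `-a i`. -/
theorem sum_signedSum_sq {ι : Type*} [DecidableEq ι] (s : Finset ι) (a : ι → ℝ) :
    ∑ t ∈ s.powerset, signedSum s t a ^ 2 = 2 ^ s.card * ∑ i ∈ s, a i ^ 2 := by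
  induction s using Finset.induction_on with
  | empty => simp [signedSum]
  | insert i s hi ih =>
    rw [sum_powerset_insert_signedSum hi a (fun x => x ^ 2), Finset.sum_insert hi,
      Finset.card_insert_of_notMem hi]
    have h : ∀ t ∈ s.powerset, (signedSum s t a - a i) ^ 2 + (signedSum s t a + a i) ^ 2 =
        2 * signedSum s t a ^ 2 + 2 * a i ^ 2 := fun t _ => by ring
    rw [Finset.sum_congr rfl h, Finset.sum_add_distrib, ← Finset.mul_sum, ih, Finset.sum_const,
      Finset.card_powerset, nsmul_eq_mul]
    push_cast
    ring

/-- Odd powers of `a i` cancel, and the surviving term `12 * a i ^ 2 * signedSum s t a ^ 2` is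
evaluated by the second moment. -/
theorem sum_signedSum_pow_four_le {ι : Type*} [DecidableEq ι] (s : Finset ι) (a : ι → ℝ) :
    ∑ t ∈ s.powerset, signedSum s t a ^ 4 ≤ 2 ^ s.card * (3 * (∑ i ∈ s, a i ^ 2) ^ 2) := by
  induction s using Finset.induction_on with
  | empty => simp [signedSum]
  | insert i s hi ih =>
    rw [sum_powerset_insert_signedSum hi a (fun x => x ^ 4), Finset.sum_insert hi,
      Finset.card_insert_of_notMem hi]
    have h : ∀ t ∈ s.powerset, (signedSum s t a - a i) ^ 4 + (signedSum s t a + a i) ^ 4 =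
        2 * signedSum s t a ^ 4 + 12 * a i ^ 2 * signedSum s t a ^ 2 + 2 * a i ^ 4 :=
      fun t _ => by ring
    rw [Finset.sum_congr rfl h, Finset.sum_add_distrib, Finset.sum_add_distrib, ← Finset.mul_sum,
      ← Finset.mul_sum, sum_signedSum_sq, Finset.sum_const, Finset.card_powerset, nsmul_eq_mul]
    have h2 : (0 : ℝ) ≤ 2 ^ s.card * a i ^ 4 := by positivity
    rw [pow_succ 2 s.card, Nat.cast_pow, Nat.cast_ofNat]
    linarith

/-- Khinchine's inequality for the first absolute moment, with `ℓ₁` norm on the left. -/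
theorem two_pow_mul_sum_abs_le {ι : Type*} [DecidableEq ι] (s : Finset ι) (a : ι → ℝ) :
    2 ^ s.card * ∑ i ∈ s, |a i| ≤ 2 * √s.card * ∑ t ∈ s.powerset, |signedSum s t a| := by
  set σ := √(∑ i ∈ s, a i ^ 2) with hσ
  have hσ0 : 0 ≤ σ := Real.sqrt_nonneg _
  have hσ2 : σ ^ 2 = ∑ i ∈ s, a i ^ 2 := Real.sq_sqrt (Finset.sum_nonneg fun i _ => sq_nonneg _)
  have hcs : ∑ i ∈ s, |a i| ≤ √s.card * σ := by
    rw [hσ, ← Real.sqrt_mul (Nat.cast_nonneg _)]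
    refine Real.le_sqrt_of_sq_le ?_
    have := sq_sum_le_card_mul_sum_sq (s := s) (f := fun i => |a i|)
    simpa only [sq_abs] using this
  have hK : 2 ^ s.card * σ ≤ 2 * ∑ t ∈ s.powerset, |signedSum s t a| := by
    rcases hσ0.eq_or_lt with h | h
    · rw [← h, mul_zero]
      exact mul_nonneg zero_le_two (Finset.sum_nonneg fun _ _ => abs_nonneg _)
    -- With `y = |x|`, the difference of the sides is `y (y - 2σ)² (y + 4σ)`. Averaging gives `12σ⁴
    -- - 3σ⁴ ≤ 16σ³ E|S|`, so `σ ≤ (16/9) E|S|`, and 2 is a convenient upper bound.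
    have hp : ∀ x : ℝ, 12 * σ ^ 2 * x ^ 2 - x ^ 4 ≤ 16 * σ ^ 3 * |x| := fun x => by
      rw [← sq_abs x, show x ^ 4 = |x| ^ 4 by rw [show (4 : ℕ) = 2 * 2 from rfl, pow_mul, pow_mul, sq_abs]]
      have hx := abs_nonneg x
      generalize |x| = y at *
      have : 0 ≤ y * ((y - 2 * σ) ^ 2 * (y + 4 * σ)) := by positivity
      nlinarith
    have hs := Finset.sum_le_sum fun t (_ : t ∈ s.powerset) => hp (signedSum s t a)
    rw [Finset.sum_sub_distrib, ← Finset.mul_sum, ← Finset.mul_sum, sum_signedSum_sq, ← hσ2] at hs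
    have h4 := sum_signedSum_pow_four_le s a
    rw [← hσ2] at h4
    have h3 : 0 < σ ^ 3 := by positivity
    have hpos : 0 ≤ 2 ^ s.card * σ := by positivity
    refine le_of_mul_le_mul_left ?_ h3
    nlinarith [mul_nonneg h3.le hpos]
  calc 2 ^ s.card * ∑ i ∈ s, |a i| ≤ 2 ^ s.card * (√s.card * σ) := by gcongr
    _ = √s.card * (2 ^ s.card * σ) := by ring
    _ ≤ √s.card * (2 * ∑ t ∈ s.powerset, |signedSum s t a|) := by gcongr
    _ = _ := by ring

/-- If the signed sums are bounded by `C` on average and all norms are at least `c > 0`,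
then the inequality of `two_pow_mul_sum_abs_le` bounds the number of vectors. -/
theorem sqrt_card_mul_le {ι : Type*} (s : Finset ι) {c C : ℝ} (N : ι → ℝ)
    (S : Finset ι → ℝ) (hN : ∀ i ∈ s, c ≤ N i) (hC : 0 ≤ C) (hS : ∀ t, S t ≤ C)
    (h : 2 ^ s.card * ∑ i ∈ s, N i ≤ 2 * √s.card * ∑ t ∈ s.powerset, S t) :
    √s.card * c ≤ 2 * C := by
  rcases s.eq_empty_or_nonempty with rfl | hs
  · simpa using hC
  have hc : 0 < √(s.card : ℝ) := Real.sqrt_pos.2 (by exact_mod_cast hs.card_pos)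
  have h1 : s.card * c ≤ ∑ i ∈ s, N i := by
    simpa using Finset.card_nsmul_le_sum s N c hN
  have h2 : ∑ t ∈ s.powerset, S t ≤ 2 ^ s.card * C := by
    simpa using Finset.sum_le_card_nsmul s.powerset S C fun t _ => hS t
  have h3 : (2 : ℝ) ^ s.card * (√s.card * (√s.card * c)) ≤ 2 ^ s.card * (√s.card * (2 * C)) := by
    rw [← mul_assoc √(s.card : ℝ), Real.mul_self_sqrt (Nat.cast_nonneg _)]
    calc (2 : ℝ) ^ s.card * (s.card * c) ≤ 2 ^ s.card * ∑ i ∈ s, N i := by gcongr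
      _ ≤ _ := h
      _ ≤ 2 * √s.card * (2 ^ s.card * C) := by gcongr
      _ = _ := by ring
  exact le_of_mul_le_mul_left (le_of_mul_le_mul_left h3 (by positivity)) hc

/-- The scalar inequality holds at almost every point, and both sides are additive in the `L¹` norm,
so it can be integrated. -/
theorem MeasureTheory.Lp.two_pow_mul_sum_norm_le {Ω : Type*} [MeasurableSpace Ω] {μ : Measure Ω}
    {ι : Type*} [DecidableEq ι] (s : Finset ι) (x : ι → Lp ℝ 1 μ) :
    2 ^ s.card * ∑ i ∈ s, ‖x i‖ ≤ 2 * √s.card * ∑ t ∈ s.powerset, ‖signedSum s t x‖ := by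
  have hx : ∀ y : Lp ℝ 1 μ, Integrable (fun ω => |y ω|) μ := fun y =>
    (L1.integrable_coeFn y).abs
  have hn : ∀ y : Lp ℝ 1 μ, ‖y‖ = ∫ ω, |y ω| ∂μ := fun y => L1.norm_eq_integral_norm y
  simp only [hn]
  rw [← integral_finsetSum _ fun i _ => hx _, ← integral_finsetSum _ fun t _ => hx _,
    ← integral_const_mul, ← integral_const_mul]
  refine integral_mono_ae ((integrable_finsetSum _ fun i _ => hx _).const_mul _)
    ((integrable_finsetSum _ fun i _ => hx _).const_mul _) ?_
  have hS : ∀ t : Finset ι, ∀ r : Finset ι,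
      (signedSum r t x : Lp ℝ 1 μ) =ᵐ[μ] fun ω => signedSum r t fun i => x i ω := by
    intro t r
    induction r using Finset.induction_on with
    | empty => exact Lp.coeFn_zero ℝ 1 μ
    | insert i r hi ih =>
      have e : signedSum (insert i r) t x = (if i ∈ t then x i else -x i) + signedSum r t x :=
        Finset.sum_insert hi
      rw [e]
      filter_upwards [ih, Lp.coeFn_add (if i ∈ t then x i else -x i) (signedSum r t x),
        Lp.coeFn_neg (x i)] with ω h1 h2 h3
      rw [h2, Pi.add_apply, h1, signedSum, signedSum, Finset.sum_insert hi]
      split_ifs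
      · rfl
      · rw [h3]; rfl
  have hall : ∀ᵐ ω ∂μ, ∀ t ∈ s.powerset,
      (signedSum s t x : Lp ℝ 1 μ) ω = signedSum s t fun i => x i ω :=
    (Finset.eventually_all _).2 fun t _ => hS t s
  filter_upwards [hall] with ω h
  have e : ∑ t ∈ s.powerset, |(signedSum s t x : Lp ℝ 1 μ) ω| =
      ∑ t ∈ s.powerset, |signedSum s t fun i => x i ω| :=
    Finset.sum_congr rfl fun t ht => by rw [h t ht]
  rw [e]
  exact two_pow_mul_sum_abs_le s fun i => x i ω

/-! ## Operators from `ℓ₁` and to `ℓ₁` -/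

theorem EllOne.hasSum_norm (a : EllOne) : HasSum (fun n => |a n|) ‖a‖ := by
  have h := lp.hasSum_norm (p := 1) (by simp) a
  simpa using h

/-- The operator `ℓ₁ → Y` which sends the unit vectors to a given bounded sequence. -/
def EllOne.lift {Y : Type*} [NormedAddCommGroup Y] [NormedSpace ℝ Y] [CompleteSpace Y]
    (y : ℕ → Y) (B : ℝ) (hy : ∀ n, ‖y n‖ ≤ B) : EllOne →L[ℝ] Y :=
  have hb (a : EllOne) (n : ℕ) : ‖a n • y n‖ ≤ |a n| * B := by
    rw [norm_smul, Real.norm_eq_abs]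
    exact mul_le_mul_of_nonneg_left (hy n) (abs_nonneg _)
  have hs (a : EllOne) : Summable fun n => a n • y n :=
    Summable.of_norm_bounded (a.hasSum_norm.summable.mul_right B) (hb a)
  LinearMap.mkContinuous
    { toFun := fun a => ∑' n, a n • y n
      map_add' := fun a b => by
        rw [← (hs a).tsum_add (hs b)]
        exact tsum_congr fun n => by rw [lp.coeFn_add, Pi.add_apply, add_smul]
      map_smul' := fun c a => by
        rw [RingHom.id_apply, ← (hs a).tsum_const_smul]
        exact tsum_congr fun n => by rw [lp.coeFn_smul, Pi.smul_apply, smul_assoc] } B fun a => by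
    rw [mul_comm]
    exact tsum_of_norm_bounded (a.hasSum_norm.mul_right B) (hb a)

theorem EllOne.hasSum_lift {Y : Type*} [NormedAddCommGroup Y] [NormedSpace ℝ Y] [CompleteSpace Y]
    (y : ℕ → Y) (B : ℝ) (hy : ∀ n, ‖y n‖ ≤ B) (a : EllOne) :
    HasSum (fun n => a n • y n) (EllOne.lift y B hy a) := by
  have hb (n : ℕ) : ‖a n • y n‖ ≤ |a n| * B := by
    rw [norm_smul, Real.norm_eq_abs]
    exact mul_le_mul_of_nonneg_left (hy n) (abs_nonneg _)
  exact (Summable.of_norm_bounded (a.hasSum_norm.summable.mul_right B) hb).hasSum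

theorem EllOne.lift_single {Y : Type*} [NormedAddCommGroup Y] [NormedSpace ℝ Y] [CompleteSpace Y]
    (y : ℕ → Y) (B : ℝ) (hy : ∀ n, ‖y n‖ ≤ B) (n : ℕ) (c : ℝ) :
    EllOne.lift y B hy (lp.single 1 n c) = c • y n := by
  refine (EllOne.hasSum_lift y B hy _).unique ?_
  have h := hasSum_single (f := fun k => (lp.single 1 n c : EllOne) k • y k) n fun k hk => by
    rw [lp.single_apply_ne _ _ _ hk, zero_smul]
  simpa using h

/-- Every separable Banach space is a quotient of `ℓ₁`. -/
theorem EllOne.exists_surjective (Y : Type*) [NormedAddCommGroup Y] [NormedSpace ℝ Y]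
    [CompleteSpace Y] [TopologicalSpace.SeparableSpace Y] :
    ∃ T : EllOne →L[ℝ] Y, Function.Surjective T := by
  have hdense := TopologicalSpace.denseRange_denseSeq Y
  -- Integer combinations form a countable dense subgroup. Each of its elements `d n` is the image
  -- of `‖d n‖` times the `n`-th unit vector, and controlled lifting extends from the subgroup to
  -- its closure.
  set L := Finsupp.linearCombination ℤ (TopologicalSpace.denseSeq Y)
  set K : AddSubgroup Y := L.range.toAddSubgroup
  obtain ⟨c, hc⟩ := exists_surjective_nat (ℕ →₀ ℤ)
  set d : ℕ → Y := fun n => L (c n) with hd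
  set y : ℕ → Y := fun n => ‖d n‖⁻¹ • d n with hy
  have hy1 : ∀ n, ‖y n‖ ≤ 1 := fun n => by
    rw [hy]
    simp only [norm_smul, norm_inv, norm_norm]
    exact inv_mul_le_one
  set T := EllOne.lift y 1 hy1 with hT
  let f : NormedAddGroupHom EllOne Y :=
    ⟨T, T.map_add, ‖T‖, T.le_opNorm⟩
  have hf : f.SurjectiveOnWith K 1 := by
    rintro k ⟨b, rfl⟩
    obtain ⟨n, rfl⟩ := hc b
    change ∃ g, f g = d n ∧ ‖g‖ ≤ 1 * ‖d n‖
    refine ⟨lp.single 1 n ‖d n‖, ?_, ?_⟩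
    · change T _ = d n
      rw [hT, EllOne.lift_single, hy]
      rcases eq_or_ne (d n) 0 with h0 | h0
      · simp [h0]
      simp only
      rw [smul_smul, mul_inv_cancel₀ (norm_ne_zero_iff.2 h0), one_smul]
    · rw [lp.norm_single (by simp), norm_norm, one_mul]
  have hcl := controlled_closure_of_complete one_pos one_pos hf
  refine ⟨T, fun z => ?_⟩
  have hz : z ∈ K.topologicalClosure := by
    have : Dense (K : Set Y) := hdense.mono <| by
      rintro _ ⟨n, rfl⟩
      exact ⟨Finsupp.single n 1, by simp [L]⟩
    exact this z
  obtain ⟨a, ha, -⟩ := hcl z hz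
  exact ⟨a, ha⟩

/-! ## Biorthogonal systems equivalent to the unit vector basis of `ℓ₁` -/

/-- A bounded sequence of vectors with biorthogonal functionals whose signed sums are uniformly
bounded. -/
structure EllOneSystem (X : Type*) [NormedAddCommGroup X] [NormedSpace ℝ X] where
  vec : ℕ → X
  dual : ℕ → StrongDual ℝ X
  vecBound : ℝ
  dualBound : ℝ
  vecBound_pos : 0 < vecBound
  norm_vec_le : ∀ n, ‖vec n‖ ≤ vecBound
  dual_vec : ∀ m n, dual m (vec n) = if m = n then 1 else 0
  norm_signedSum_le : ∀ s t, ‖signedSum s t dual‖ ≤ dualBound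

namespace EllOneSystem

variable {X : Type*} [NormedAddCommGroup X] [NormedSpace ℝ X] (S : EllOneSystem X)

theorem dualBound_nonneg : 0 ≤ S.dualBound := (norm_nonneg _).trans (S.norm_signedSum_le ∅ ∅)

theorem norm_dual_le (n : ℕ) : ‖S.dual n‖ ≤ S.dualBound := by
  simpa [signedSum] using S.norm_signedSum_le {n} {n}

/-- Transport along a pair of operators `X → W → X` whose composition is the identity. -/
def transport {W : Type*} [NormedAddCommGroup W] [NormedSpace ℝ W] (J : X →L[ℝ] W) (P : W →L[ℝ] X)
    (h : ∀ x, P (J x) = x) : EllOneSystem W where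
  vec n := J (S.vec n)
  dual n := (S.dual n).comp P
  vecBound := (‖J‖ + 1) * S.vecBound
  dualBound := S.dualBound * ‖P‖
  vecBound_pos := mul_pos (by positivity) S.vecBound_pos
  norm_vec_le n := (J.le_opNorm _).trans (mul_le_mul (by simp) (S.norm_vec_le n)
    (norm_nonneg _) (by positivity))
  dual_vec m n := by
    rw [ContinuousLinearMap.comp_apply, h, S.dual_vec]
  norm_signedSum_le s t := by
    have e : signedSum s t (fun n => (S.dual n).comp P) = (signedSum s t S.dual).comp P :=
      (map_signedSum (ContinuousLinearMap.precomp ℝ P) s t S.dual).symm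
    rw [e]
    exact (ContinuousLinearMap.opNorm_comp_le _ _).trans
      (mul_le_mul_of_nonneg_right (S.norm_signedSum_le s t) (norm_nonneg _))

/-- Signs chosen to match those of `Φ (S.dual n)` turn the sum into `Φ` of one signed sum. Taking
`Φ` in the bidual makes the series of functionals weakly unconditionally Cauchy. -/
theorem sum_abs_le (Φ : StrongDual ℝ (StrongDual ℝ X)) (s : Finset ℕ) :
    ∑ n ∈ s, |Φ (S.dual n)| ≤ S.dualBound * ‖Φ‖ := by
  have e : ∑ n ∈ s, |Φ (S.dual n)| = Φ (signedSum s (s.filter fun n => 0 ≤ Φ (S.dual n)) S.dual) := by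
    rw [map_signedSum]
    refine Finset.sum_congr rfl fun n hn => ?_
    by_cases h : 0 ≤ Φ (S.dual n)
    · simp [hn, h, abs_of_nonneg h]
    · simp [h, abs_of_neg (not_le.1 h)]
  rw [e, mul_comm]
  exact (le_abs_self _).trans ((Φ.le_opNorm _).trans
    (mul_le_mul_of_nonneg_left (S.norm_signedSum_le _ _) (norm_nonneg _)))

theorem sum_abs_apply_le (x : X) (s : Finset ℕ) :
    ∑ n ∈ s, |S.dual n x| ≤ S.dualBound * ‖x‖ :=
  (S.sum_abs_le (NormedSpace.inclusionInDoubleDual ℝ X x) s).trans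
    (mul_le_mul_of_nonneg_left (NormedSpace.double_dual_bound ℝ X x) S.dualBound_nonneg)

/-- The operator `x ↦ (φ n x)` into `ℓ₁`. -/
def toEllOne : X →L[ℝ] EllOne :=
  have hmem (x : X) : Memℓp (fun n => S.dual n x) 1 :=
    memℓp_gen' (C := S.dualBound * ‖x‖) fun s => by simpa using S.sum_abs_apply_le x s
  LinearMap.mkContinuous
    { toFun := fun x => (⟨fun n => S.dual n x, hmem x⟩ : EllOne)
      map_add' := fun x y => lp.ext (funext fun n => map_add (S.dual n) x y)
      map_smul' := fun c x => lp.ext (funext fun n => map_smul (S.dual n) c x) } S.dualBound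
    fun x => by
      refine hasSum_le_of_sum_le (EllOne.hasSum_norm _) fun s => ?_
      exact S.sum_abs_apply_le x s

@[simp] theorem toEllOne_apply (x : X) (n : ℕ) : S.toEllOne x n = S.dual n x := rfl

/-- A weak limit of the partial sums would be 1 on every vector. By Mazur it would also lie in the
norm closure of the functionals that tend to 0 along the vectors. -/
theorem not_isWeaklySequentiallyComplete (S : EllOneSystem X) :
    ¬ IsWeaklySequentiallyComplete (StrongDual ℝ X) := by
  intro hw
  have hsum (Φ : StrongDual ℝ (StrongDual ℝ X)) : Summable fun n => Φ (S.dual n) :=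
    (summable_of_sum_le (fun n => abs_nonneg (Φ (S.dual n))) (S.sum_abs_le Φ)).of_abs
  have hpart (Φ : StrongDual ℝ (StrongDual ℝ X)) (N : ℕ) :
      Φ (∑ n ∈ Finset.range N, S.dual n) = ∑ n ∈ Finset.range N, Φ (S.dual n) := map_sum _ _ _
  obtain ⟨a, ha⟩ := hw (fun N => ∑ n ∈ Finset.range N, S.dual n) fun Φ => by
    simp only [hpart]
    exact (hsum Φ).hasSum.tendsto_sum_nat.cauchySeq
  have hav (k : ℕ) : a (S.vec k) = 1 := by
    refine tendsto_nhds_unique (ha (NormedSpace.inclusionInDoubleDual ℝ X (S.vec k))) ?_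
    refine tendsto_const_nhds.congr' ?_
    filter_upwards [eventually_gt_atTop k] with N hN
    rw [hpart]
    simp [S.dual_vec, hN]
  let W : Submodule ℝ (StrongDual ℝ X) :=
    { carrier := {h | Tendsto (fun k => h (S.vec k)) atTop (𝓝 0)}
      zero_mem' := tendsto_const_nhds
      add_mem' := fun {g h} hg hh => by simpa using Tendsto.add hg hh
      smul_mem' := fun c h hh => by simpa using Tendsto.const_mul c hh }
  have hdW (n : ℕ) : S.dual n ∈ W := by
    refine tendsto_const_nhds.congr' ?_
    filter_upwards [eventually_gt_atTop n] with k hk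
    rw [S.dual_vec, if_neg hk.ne]
  have haW : a ∉ W.topologicalClosure := by
    intro h
    obtain ⟨g, hg, hag⟩ := Metric.mem_closure_iff.1 h (2 * S.vecBound)⁻¹
      (inv_pos.2 (mul_pos two_pos S.vecBound_pos))
    have hlim : Tendsto (fun k => |a (S.vec k) - g (S.vec k)|) atTop (𝓝 |1 - 0|) := by
      simp only [hav]
      exact (tendsto_const_nhds.sub hg).abs
    have hle : |1 - 0| ≤ (1 / 2 : ℝ) := le_of_tendsto' hlim fun k => by
      have h1 := (a - g).le_opNorm (S.vec k)
      rw [dist_eq_norm] at hag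
      calc |a (S.vec k) - g (S.vec k)| ≤ ‖a - g‖ * ‖S.vec k‖ := h1
        _ ≤ (2 * S.vecBound)⁻¹ * S.vecBound :=
          mul_le_mul hag.le (S.norm_vec_le k) (norm_nonneg _)
            (inv_nonneg.2 (mul_pos two_pos S.vecBound_pos).le)
        _ = 1 / 2 := by field_simp [S.vecBound_pos.ne']
    norm_num at hle
  obtain ⟨Φ, u, hW, ha'⟩ := geometric_hahn_banach_closed_point
    W.topologicalClosure.convex W.isClosed_topologicalClosure haW
  refine not_le.2 ha' (le_of_tendsto' (ha Φ) fun N => (hW _ ?_).le)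
  exact W.le_topologicalClosure (W.sum_mem fun n _ => hdW n)

variable [CompleteSpace X]

theorem toEllOne_lift (a : EllOne) :
    S.toEllOne (EllOne.lift S.vec S.vecBound S.norm_vec_le a) = a := by
  refine lp.ext (funext fun n => ?_)
  have h := (EllOne.hasSum_lift S.vec S.vecBound S.norm_vec_le a).mapL (S.dual n)
  rw [toEllOne_apply]
  refine h.unique ?_
  have h1 := hasSum_single (f := fun k => S.dual n (a k • S.vec k)) n fun k hk => by
    rw [map_smul, S.dual_vec, if_neg hk.symm, smul_zero]
  simpa [S.dual_vec] using h1

theorem surjective_toEllOne : Function.Surjective S.toEllOne :=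
  fun a => ⟨_, S.toEllOne_lift a⟩

/-- The coordinate map is a left inverse of the lift, so lifting the coordinates is a projection
onto the range of the lift. -/
theorem hasComplementedCopy (S : EllOneSystem X) : HasComplementedCopy X EllOne := by
  set L := EllOne.lift S.vec S.vecBound S.norm_vec_le
  have hL : ∀ a, S.toEllOne (L a) = a := S.toEllOne_lift
  let L' : EllOne →L[ℝ] L.range := L.rangeRestrict
  refine ⟨L.range, ⟨L'.comp S.toEllOne, ?_⟩, ⟨ContinuousLinearEquiv.equivOfInverse L'
    (S.toEllOne.comp L.range.subtypeL) hL ?_⟩⟩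
  · rintro ⟨_, a, rfl⟩
    exact Subtype.ext (congrArg L (hL a))
  · rintro ⟨_, a, rfl⟩
    exact Subtype.ext (congrArg L (hL a))

end EllOneSystem

/-! ### Spaces without `ℓ₁`-systems: `L¹` duals and `C(K)` -/

namespace EllOneSystem

variable {X : Type*} [NormedAddCommGroup X] [NormedSpace ℝ X] (S : EllOneSystem X)

theorem norm_signedSum_fin_le (n : ℕ) (t : Finset (Fin n)) :
    ‖signedSum Finset.univ t fun i : Fin n => S.dual i‖ ≤ S.dualBound := by
  have h := S.norm_signedSum_le ((Finset.univ : Finset (Fin n)).map Fin.valEmbedding) (t.map Fin.valEmbedding)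
  have e (i : Fin n) : (i : ℕ) ∈ t.map Fin.valEmbedding ↔ i ∈ t := Finset.mem_map' Fin.valEmbedding
  simpa only [signedSum, Finset.sum_map, Fin.valEmbedding_apply, e] using h

theorem exists_lt_sqrt_mul {c : ℝ} (hc : 0 < c) (C : ℝ) : ∃ n : ℕ, C < √n * c := by
  obtain ⟨n, hn⟩ := exists_nat_gt ((C / c) ^ 2)
  refine ⟨n, (div_lt_iff₀ hc).1 (Real.lt_sqrt_of_sq_lt hn)⟩

/-- The dual of a space with an `ℓ₁`-system is not an `L¹`-space. -/
theorem not_dual_isometric_lp_one (S : EllOneSystem X) {Ω : Type*} [MeasurableSpace Ω] {μ : Measure Ω}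
    (U : StrongDual ℝ X ≃ₗᵢ[ℝ] Lp ℝ 1 μ) : False := by
  obtain ⟨n, hn⟩ := exists_lt_sqrt_mul (inv_pos.2 S.vecBound_pos) (2 * S.dualBound)
  have h := sqrt_card_mul_le (c := S.vecBound⁻¹) (C := S.dualBound) (Finset.range n)
    (fun i => ‖U (S.dual i)‖) (fun t => ‖signedSum (Finset.range n) t fun i => U (S.dual i)‖)
    (fun i _ => ?_) S.dualBound_nonneg (fun t => ?_) (Lp.two_pow_mul_sum_norm_le _ _)
  · rw [Finset.card_range] at h
    exact not_le.2 hn h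
  · rw [U.norm_map, inv_le_iff_one_le_mul₀ S.vecBound_pos]
    have h1 := (S.dual i).le_opNorm (S.vec i)
    rw [S.dual_vec, if_pos rfl, norm_one] at h1
    exact h1.trans (mul_le_mul_of_nonneg_left (S.norm_vec_le i) (norm_nonneg _))
  · rw [← map_signedSum U, U.norm_map]
    exact S.norm_signedSum_le _ _

/-- The vectors of an `ℓ₁`-system do not factor uniformly through spaces `ℓ_∞(κ)` with `κ` finite,
not even up to an error which the functionals detect. -/
theorem not_factor_sup {B D : ℝ} (hB : 0 < B) (hD : 0 ≤ D)
    (h : ∀ n : ℕ, ∃ (κ : Type v) (_ : Fintype κ) (g : (κ → ℝ) →L[ℝ] X) (y : Fin n → κ → ℝ),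
      (∀ z, ‖g z‖ ≤ D * ‖z‖) ∧ ∀ i : Fin n, ‖y i‖ ≤ B ∧ 1 / 2 ≤ S.dual i (g (y i))) : False := by
  classical
  have hc : 0 < (2 * B)⁻¹ := by positivity
  obtain ⟨n, hn⟩ := exists_lt_sqrt_mul hc (2 * (S.dualBound * D))
  obtain ⟨κ, _, g, y, hg, hy⟩ := h n
  have hexp (ψ : StrongDual ℝ X) (z : κ → ℝ) : ψ (g z) = ∑ k, z k * ψ (g (Pi.single k 1)) := by
    conv_lhs => rw [pi_eq_sum_univ' z]
    simp only [map_sum, map_smul, smul_eq_mul]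
  -- The functionals pulled back along `g` live in the dual `ℓ₁(κ)`. Their norms are at least
  -- `1/(2B)`, since they are at least `1/2` on vectors of norm at most `B`.
  have h := sqrt_card_mul_le (c := (2 * B)⁻¹) (C := S.dualBound * D) (Finset.univ : Finset (Fin n))
    (fun i => ∑ k, |S.dual i (g (Pi.single k 1))|)
    (fun t => ∑ k, |signedSum Finset.univ t fun i : Fin n => S.dual i (g (Pi.single k 1))|)
    (fun i _ => ?_) (mul_nonneg S.dualBound_nonneg hD) (fun t => ?_) ?_
  · rw [Finset.card_univ, Fintype.card_fin] at h
    exact not_le.2 hn h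
  · obtain ⟨h1, h2⟩ := hy i
    rw [hexp] at h2
    rw [inv_le_iff_one_le_mul₀ (by positivity)]
    have h3 : ∑ k, y i k * S.dual i (g (Pi.single k 1)) ≤
        ∑ k, B * |S.dual i (g (Pi.single k 1))| := by
      refine Finset.sum_le_sum fun k _ => (le_abs_self _).trans ?_
      rw [abs_mul]
      exact mul_le_mul_of_nonneg_right ((norm_le_pi_norm (y i) k).trans h1) (abs_nonneg _)
    rw [← Finset.mul_sum] at h3
    linarith
  · set ψ := signedSum Finset.univ t fun i : Fin n => S.dual i with hψ
    have e (k : κ) : signedSum Finset.univ t (fun i : Fin n => S.dual i (g (Pi.single k 1))) =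
        ψ (g (Pi.single k 1)) :=
      (map_signedSum (ContinuousLinearMap.apply ℝ ℝ (g (Pi.single k 1))) _ _ _).symm
    simp only [e]
    -- The sign vector is norming for the `ℓ₁` norm of the pulled-back `ψ`.
    set z : κ → ℝ := fun k => SignType.sign (ψ (g (Pi.single k 1))) with hz
    have hz1 : ‖z‖ ≤ 1 := (pi_norm_le_iff_of_nonneg zero_le_one).2 fun k => by
      rw [hz, Real.norm_eq_abs]
      rcases lt_trichotomy (ψ (g (Pi.single k 1))) 0 with h | h | h <;> simp [h]
    calc ∑ k, |ψ (g (Pi.single k 1))| = ψ (g z) := by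
          rw [hexp]
          exact Finset.sum_congr rfl fun k _ => (sign_mul_self _).symm
      _ ≤ ‖ψ‖ * ‖g z‖ := (le_abs_self _).trans (ψ.le_opNorm _)
      _ ≤ S.dualBound * (D * 1) := mul_le_mul (S.norm_signedSum_fin_le n t)
          ((hg z).trans (mul_le_mul_of_nonneg_left hz1 hD)) (norm_nonneg _) S.dualBound_nonneg
      _ = S.dualBound * D := by rw [mul_one]
  · rw [Finset.sum_comm, Finset.sum_comm (s := Finset.powerset _), Finset.mul_sum, Finset.mul_sum]
    exact Finset.sum_le_sum fun k _ => two_pow_mul_sum_abs_le _ _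

/-- Spaces of continuous functions on compact spaces carry no `ℓ₁`-system. -/
theorem not_continuousMap {K : Type v} [TopologicalSpace K] [CompactSpace K] [T2Space K]
    (S : EllOneSystem C(K, ℝ)) : False := by
  refine S.not_factor_sup S.vecBound_pos zero_le_one fun n => ?_
  -- An approximation error `δ` costs a functional at most `1/2`; the `+ 1` keeps `δ` well defined
  -- and positive if `dualBound` is 0.
  set δ : ℝ := (2 * (S.dualBound + 1))⁻¹ with hδ
  have hC := S.dualBound_nonneg
  have hδ0 : 0 < δ := by positivity
  let F : K → Fin n → ℝ := fun x i => S.vec i x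
  have hF : Continuous F := continuous_pi fun i => (S.vec i).continuous
  let U : K → Set K := fun p => F ⁻¹' Metric.ball (F p) δ
  have hU (p : K) : IsOpen (U p) := Metric.isOpen_ball.preimage hF
  obtain ⟨t, ht⟩ := CompactSpace.elim_nhds_subcover U fun p =>
    (hU p).mem_nhds (Metric.mem_ball_self hδ0)
  obtain ⟨f, hf⟩ := PartitionOfUnity.exists_isSubordinate isClosed_univ (fun p : t => U p)
    (fun p => hU p) (by
      intro x _
      have hx : x ∈ ⋃ p ∈ t, U p := by rw [ht]; trivial
      obtain ⟨p, hp, hxp⟩ := Set.mem_iUnion₂.1 hx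
      exact Set.mem_iUnion.2 ⟨⟨p, hp⟩, hxp⟩)
  have hsum (x : K) : ∑ p : t, f p x = 1 := by
    rw [← finsum_eq_sum_of_fintype]
    exact f.sum_eq_one (Set.mem_univ x)
  -- Interpolation by a partition of unity is a contraction. It nearly recovers each of the first
  -- `n` vectors from its values at `t`, as these vectors vary by less than `δ` from the value at
  -- `p` on `U p`.
  let g : (t → ℝ) →L[ℝ] C(K, ℝ) := ∑ p : t, (ContinuousLinearMap.proj p).smulRight (f p)
  have hg (z : t → ℝ) (x : K) : g z x = ∑ p : t, z p * f p x := by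
    simp [g]
  refine ⟨t, inferInstance, g, fun i p => S.vec i p, fun z => ?_, fun i => ⟨?_, ?_⟩⟩
  · rw [one_mul, ContinuousMap.norm_le _ (norm_nonneg _)]
    intro x
    rw [hg, ← mul_one ‖z‖, ← hsum x, Finset.mul_sum]
    refine (norm_sum_le _ _).trans (Finset.sum_le_sum fun p _ => ?_)
    rw [norm_mul, Real.norm_of_nonneg (f.nonneg p x)]
    exact mul_le_mul_of_nonneg_right (norm_le_pi_norm z p) (f.nonneg p x)
  · refine (pi_norm_le_iff_of_nonneg S.vecBound_pos.le).2 fun p => ?_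
    exact ((S.vec i).norm_coe_le_norm p).trans (S.norm_vec_le i)
  · set q : C(K, ℝ) := g fun p => S.vec i p with hq
    have hclose : ‖S.vec i - q‖ ≤ δ := by
      rw [ContinuousMap.norm_le _ hδ0.le]
      intro x
      have e : (S.vec i - q) x = ∑ p : t, (S.vec i x - S.vec i p) * f p x := by
        simp only [sub_mul, Finset.sum_sub_distrib, ← Finset.mul_sum, hsum, mul_one]
        rw [ContinuousMap.sub_apply, hq, hg]
      rw [e, ← mul_one δ, ← hsum x, Finset.mul_sum]
      refine (norm_sum_le _ _).trans (Finset.sum_le_sum fun p _ => ?_)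
      rw [norm_mul, Real.norm_of_nonneg (f.nonneg p x)]
      rcases eq_or_ne (f p x) 0 with h0 | h0
      · rw [h0, mul_zero, mul_zero]
      have hx : x ∈ U p := hf p (subset_tsupport _ h0)
      exact mul_le_mul_of_nonneg_right
        ((dist_le_pi_dist (F x) (F p) i).trans (Metric.mem_ball.1 hx).le) (f.nonneg p x)
    have h1 := (le_abs_self _).trans ((S.dual i).le_opNorm (S.vec i - q))
    rw [map_sub, S.dual_vec, if_pos rfl] at h1
    have h2 : ‖S.dual i‖ * ‖S.vec i - q‖ ≤ (S.dualBound + 1) * δ :=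
      mul_le_mul ((S.norm_dual_le i).trans (by linarith)) hclose (norm_nonneg _) (by linarith)
    have h3 : (S.dualBound + 1) * δ = 1 / 2 := by
      rw [hδ]
      field_simp
    linarith

end EllOneSystem

/-! ## Renorming a vector space -/

/-- A real vector space, normed by a given positive definite seminorm. -/
def Renormed {V : Type*} [AddCommGroup V] [Module ℝ V] (p : Seminorm ℝ V)
    (_ : ∀ x, p x = 0 → x = 0) : Type _ := V

namespace Renormed

variable {V : Type*} [AddCommGroup V] [Module ℝ V] {p : Seminorm ℝ V} {hp : ∀ x, p x = 0 → x = 0}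

instance : AddCommGroup (Renormed p hp) := inferInstanceAs (AddCommGroup V)

instance : Module ℝ (Renormed p hp) := inferInstanceAs (Module ℝ V)

instance : Norm (Renormed p hp) := ⟨p⟩

instance : NormedAddCommGroup (Renormed p hp) := NormedAddCommGroup.ofCore (𝕜 := ℝ)
  { norm_nonneg := apply_nonneg p
    norm_smul := map_smul_eq_mul p
    norm_triangle := map_add_le_add p
    norm_eq_zero_iff := fun x => ⟨hp x, fun h => h ▸ map_zero p⟩ }

instance : NormedSpace ℝ (Renormed p hp) where
  norm_smul_le c x := (map_smul_eq_mul p c x).le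

/-- The identity map onto the renormed space. -/
def equiv (p : Seminorm ℝ V) (hp : ∀ x, p x = 0 → x = 0) : V ≃ₗ[ℝ] Renormed p hp :=
  LinearEquiv.refl ℝ V

instance [FiniteDimensional ℝ V] : FiniteDimensional ℝ (Renormed p hp) :=
  inferInstanceAs (FiniteDimensional ℝ V)

end Renormed

/-- For linear maps `L : A → X` and `j : A → Y`, the seminorm `y ↦ inf (‖L a‖ + B ‖y - j a‖)` on
`Y`, with the infimum over `a`. -/
def gluedSeminorm {A X Y : Type*} [AddCommGroup A] [Module ℝ A] [NormedAddCommGroup X]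
    [NormedSpace ℝ X] [NormedAddCommGroup Y] [NormedSpace ℝ Y] (L : A →ₗ[ℝ] X) (j : A →ₗ[ℝ] Y)
    (B : ℝ) (hB : 0 ≤ B) : Seminorm ℝ Y :=
  have hpos (y : Y) (a : A) : 0 ≤ ‖L a‖ + B * ‖y - j a‖ := by positivity
  have hbdd (y : Y) : BddBelow (Set.range fun a => ‖L a‖ + B * ‖y - j a‖) :=
    ⟨0, by rintro _ ⟨a, rfl⟩; exact hpos y a⟩
  Seminorm.ofSMulLE (fun y => ⨅ a, (‖L a‖ + B * ‖y - j a‖))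
    (le_antisymm ((ciInf_le (hbdd 0) 0).trans (by simp)) (Real.iInf_nonneg (hpos 0)))
    (fun y z => le_ciInf_add_ciInf fun a b => (ciInf_le (hbdd _) (a + b)).trans (by
      have h1 := norm_add_le (L a) (L b)
      have h2 := norm_add_le (y - j a) (z - j b)
      rw [map_add, map_add, show y + z - (j a + j b) = y - j a + (z - j b) by abel]
      linarith [mul_le_mul_of_nonneg_left h2 hB]))
    (fun c y => by
      rw [Real.mul_iInf_of_nonneg (norm_nonneg c)]
      refine le_ciInf fun a => (ciInf_le (hbdd _) (c • a)).trans (le_of_eq ?_)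
      rw [map_smul, map_smul, ← smul_sub, norm_smul, norm_smul]
      ring)

section gluedSeminorm

variable {A X Y : Type*} [AddCommGroup A] [Module ℝ A] [NormedAddCommGroup X]
  [NormedSpace ℝ X] [NormedAddCommGroup Y] [NormedSpace ℝ Y] {L : A →ₗ[ℝ] X} {j : A →ₗ[ℝ] Y}
  {B : ℝ} {hB : 0 ≤ B}

theorem gluedSeminorm_le (y : Y) (a : A) :
    gluedSeminorm L j B hB y ≤ ‖L a‖ + B * ‖y - j a‖ :=
  ciInf_le ⟨0, by rintro _ ⟨a, rfl⟩; positivity⟩ a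

theorem le_gluedSeminorm {y : Y} {c : ℝ} (h : ∀ a, c ≤ ‖L a‖ + B * ‖y - j a‖) :
    c ≤ gluedSeminorm L j B hB y := le_ciInf h

/-- The bound on `L` makes a detour through another `b` no cheaper than `a` itself. -/
theorem gluedSeminorm_apply_map (h : ∀ a, ‖L a‖ ≤ B * ‖j a‖) (a : A) :
    gluedSeminorm L j B hB (j a) = ‖L a‖ := by
  refine le_antisymm ((gluedSeminorm_le _ a).trans (by simp)) (le_gluedSeminorm fun b => ?_)
  have h1 := norm_add_le (L b) (L (a - b))
  rw [← map_add, add_sub_cancel] at h1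
  have h2 := h (a - b)
  rw [map_sub j] at h2
  linarith

theorem gluedSeminorm_le_mul (y : Y) : gluedSeminorm L j B hB y ≤ B * ‖y‖ :=
  (gluedSeminorm_le y 0).trans (by simp)

/-- The triangle inequality for `y = j a + (y - j a)`; this makes the seminorm definite. -/
theorem norm_le_mul_gluedSeminorm {C : ℝ} (h : ∀ a, ‖j a‖ ≤ C * ‖L a‖) (hC : 1 ≤ C * B)
    (hC0 : 0 < C) (y : Y) : ‖y‖ ≤ C * gluedSeminorm L j B hB y := by
  rw [← div_le_iff₀' hC0]
  refine le_gluedSeminorm fun a => ?_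
  rw [div_le_iff₀' hC0]
  have h1 := norm_add_le (j a) (y - j a)
  rw [add_sub_cancel] at h1
  have h2 := mul_le_mul_of_nonneg_right hC (norm_nonneg (y - j a))
  linarith [h a]

end gluedSeminorm

/-! ## The Gurariĭ space -/

/-- The embedding of `ℓ₁ⁿ` into `ℓ_∞` over the set of signs. -/
def signEmbedding (n : ℕ) : (Fin n → ℝ) →ₗ[ℝ] (Finset (Fin n) → ℝ) where
  toFun a t := signedSum Finset.univ t a
  map_add' a b := funext fun t => by
    simp only [signedSum, Pi.add_apply, ← Finset.sum_add_distrib]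
    exact Finset.sum_congr rfl fun i _ => by split_ifs <;> ring
  map_smul' c a := funext fun t => by
    simp only [signedSum, Pi.smul_apply, smul_eq_mul, RingHom.id_apply, Finset.mul_sum]
    exact Finset.sum_congr rfl fun i _ => by split_ifs <;> ring

/-- The supremum is attained at the set of nonnegative coordinates. -/
theorem norm_signEmbedding {n : ℕ} (a : Fin n → ℝ) : ‖signEmbedding n a‖ = ∑ i, |a i| := by
  refine le_antisymm ?_ ?_
  · refine (pi_norm_le_iff_of_nonneg (Finset.sum_nonneg fun _ _ => abs_nonneg _)).2 fun t => ?_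
    refine (norm_sum_le Finset.univ fun i => if i ∈ t then a i else -a i).trans
      (Finset.sum_le_sum fun i _ => ?_)
    split_ifs <;> simp
  · have h := norm_le_pi_norm (signEmbedding n a) (Finset.univ.filter fun i => 0 ≤ a i)
    refine le_trans (le_of_eq ?_) ((le_abs_self _).trans h)
    refine Finset.sum_congr rfl fun i _ => ?_
    by_cases hi : 0 ≤ a i
    · simp [hi, abs_of_nonneg hi]
    · simp [hi, abs_of_neg (not_le.1 hi)]

/-- The Gurariĭ space carries no `ℓ₁`-system. -/
theorem EllOneSystem.not_isGurariiSpace {G : Type v} [NormedAddCommGroup G] [NormedSpace ℝ G]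
    (S : EllOneSystem G) (hG : IsGurariiSpace G) : False := by
  have hB := S.vecBound_pos
  have hC := S.dualBound_nonneg
  refine S.not_factor_sup (D := 2 * S.vecBound) one_pos (by positivity) fun n => ?_
  let L : (Fin n → ℝ) →ₗ[ℝ] G := Fintype.linearCombination ℝ fun i : Fin n => S.vec i
  have hL (a : Fin n → ℝ) : L a = ∑ i, a i • S.vec i := Fintype.linearCombination_apply ..
  let j := signEmbedding n
  have hLj (a : Fin n → ℝ) : ‖L a‖ ≤ S.vecBound * ‖j a‖ := by
    rw [hL, norm_signEmbedding, mul_comm, Finset.sum_mul]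
    refine (norm_sum_le _ _).trans (Finset.sum_le_sum fun i _ => ?_)
    rw [norm_smul, Real.norm_eq_abs]
    exact mul_le_mul_of_nonneg_left (S.norm_vec_le i) (abs_nonneg _)
  have hjL (a : Fin n → ℝ) : ‖j a‖ ≤ S.dualBound * ‖L a‖ := by
    have h := S.sum_abs_apply_le (L a) ((Finset.univ : Finset (Fin n)).map Fin.valEmbedding)
    rw [norm_signEmbedding]
    refine le_trans (le_of_eq ?_) h
    rw [Finset.sum_map]
    refine Finset.sum_congr rfl fun i _ => ?_
    simp [hL, S.dual_vec, Fin.val_inj]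
  -- This norm on the finite `ℓ_∞` makes the copy of `ℝⁿ` isometric to the span of the first `n`
  -- vectors, while staying at most `vecBound` times the sup norm.
  let p := gluedSeminorm L j S.vecBound hB.le
  have hp : ∀ y, p y = 0 → y = 0 := fun y hy => by
    -- The summand `vecBound⁻¹` secures `1 ≤ C * B` and `0 < C`.
    have h := norm_le_mul_gluedSeminorm (hB := hB.le) (C := S.dualBound + S.vecBound⁻¹) (fun a =>
      (hjL a).trans (mul_le_mul_of_nonneg_right (by simpa using hB.le) (norm_nonneg _)))
      (by rw [add_mul, inv_mul_cancel₀ hB.ne']; linarith [mul_nonneg hC hB.le])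
      (by positivity) y
    change ‖y‖ ≤ _ * p y at h
    rw [hy, mul_zero] at h
    exact norm_le_zero_iff.1 h
  let ι := Renormed.equiv p hp
  let J : (Fin n → ℝ) →ₗ[ℝ] Renormed p hp := ι.toLinearMap ∘ₗ j
  have hJn (a : Fin n → ℝ) : ‖J a‖ = ‖L a‖ := gluedSeminorm_apply_map hLj a
  have hJ : Function.Injective J := ι.injective.comp <| by
    refine (injective_iff_map_eq_zero j).2 fun a ha => funext fun i => ?_
    have h : ∑ i, |a i| = 0 := by
      rw [← norm_signEmbedding]
      exact norm_eq_zero.2 ha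
    exact abs_eq_zero.1 ((Finset.sum_eq_zero_iff_of_nonneg fun _ _ => abs_nonneg _).1 h i
      (Finset.mem_univ i))
  let Je := LinearEquiv.ofInjective J hJ
  let f : J.range →ₗᵢ[ℝ] G := ⟨L ∘ₗ Je.symm.toLinearMap, fun x => by
    obtain ⟨a, rfl⟩ := Je.surjective x
    rw [LinearMap.comp_apply, LinearEquiv.coe_coe, Je.symm_apply_apply, ← hJn]
    rfl⟩
  have hf (a : Fin n → ℝ) : f (Je a) = L a := congrArg L (Je.symm_apply_apply a)
  -- Any fixed `ε` would do; `ε = 1` produces the factor 2 in `D`.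
  obtain ⟨g, hgf, hg⟩ := hG.extension (Renormed p hp) J.range f 1 one_pos
  have hg' (y : Finset (Fin n) → ℝ) : ‖g (ι y)‖ ≤ 2 * S.vecBound * ‖y‖ := by
    refine ((hg (ι y)).2).trans ?_
    rw [mul_assoc, one_add_one_eq_two]
    exact mul_le_mul_of_nonneg_left (gluedSeminorm_le_mul y) zero_le_two
  let g' : (Finset (Fin n) → ℝ) →L[ℝ] G :=
    LinearMap.mkContinuous (g.toLinearMap ∘ₗ ι.toLinearMap) (2 * S.vecBound) hg'
  refine ⟨Finset (Fin n), inferInstance, g', fun i => j (Pi.single i 1), hg',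
    fun i => ⟨?_, ?_⟩⟩
  · rw [norm_signEmbedding]
    refine le_of_eq ((Finset.sum_eq_single i (fun k _ hk => ?_) (by simp)).trans (by simp))
    simp [hk]
  · have e : g' (j (Pi.single i 1)) = S.vec i := by
      change g (J (Pi.single i 1)) = _
      have h := hgf (Je (Pi.single i 1))
      rw [hf, hL] at h
      refine h.trans ?_
      simp [Pi.single_apply]
    rw [e, S.dual_vec, if_pos rfl]
    norm_num

/-! ## Disjoint balls in infinite metric spaces -/

/-- A sequence of disjoint balls, and for each ball a point outside all balls whose distance to
the centre is comparable to the radius. -/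
structure DisjointBalls (M : Type*) [MetricSpace M] where
  center : ℕ → M
  outer : ℕ → M
  radius : ℕ → ℝ
  ratio : ℝ
  radius_pos : ∀ n, 0 < radius n
  add_radius_le : ∀ m n, m ≠ n → radius m + radius n ≤ dist (center m) (center n)
  radius_le : ∀ m n, radius n ≤ dist (outer m) (center n)
  dist_le : ∀ n, dist (center n) (outer n) ≤ ratio * radius n

/-- Disjoint balls around points on which a nonexpansive function takes values that grow or decay
geometrically. -/
def DisjointBalls.ofLacunary {M : Type*} [MetricSpace M] (ρ : M → ℝ)
    (hρ : ∀ x y, |ρ x - ρ y| ≤ dist x y) (x y : ℕ → M) (C : ℝ) (hx : ∀ n, 0 < ρ (x n))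
    (hxx : ∀ m n, m ≠ n → 4 * ρ (x m) ≤ ρ (x n) ∨ 4 * ρ (x n) ≤ ρ (x m))
    (hxy : ∀ m n, 4 * ρ (x n) ≤ ρ (y m) ∨ 4 * ρ (y m) ≤ ρ (x n))
    (hd : ∀ n, dist (x n) (y n) ≤ C * ρ (x n)) : DisjointBalls M where
  center := x
  outer := y
  -- If two values of `ρ` differ by a factor of at least 4, their points are at least `3/4` of the
  -- larger value apart, which exceeds the sum of the radii.
  radius n := ρ (x n) / 4
  ratio := 4 * C
  radius_pos n := div_pos (hx n) four_pos
  add_radius_le m n hmn := by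
    obtain ⟨h1, h2⟩ := abs_le.1 (hρ (x m) (x n))
    have hm := hx m
    have hn := hx n
    rcases hxx m n hmn with h | h <;> linarith
  radius_le m n := by
    obtain ⟨h1, h2⟩ := abs_le.1 (hρ (y m) (x n))
    have hn := hx n
    rcases hxy m n with h | h <;> linarith
  dist_le n := (hd n).trans (le_of_eq (by ring))

/-- Distances to `o` can be made to grow geometrically, and `o` itself serves as every outer point.
-/
theorem DisjointBalls.nonempty_of_unbounded {M : Type*} [MetricSpace M] (o : M)
    (h : ∀ R : ℝ, ∃ x, R < dist x o) : Nonempty (DisjointBalls M) := by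
  obtain ⟨z, hz0, hz⟩ := exists_seq_of_forall_finset_exists (fun x : M => 0 < dist x o)
    (fun x y => 4 * dist x o ≤ dist y o) fun s _ => by
      obtain ⟨b, hb⟩ := (s.finite_toSet.image fun x : M => 4 * dist x o).bddAbove
      obtain ⟨y, hy⟩ := h (max b 0)
      exact ⟨y, (le_max_right _ _).trans_lt hy, fun x hx =>
        (hb ⟨x, hx, rfl⟩).trans ((le_max_left _ _).trans hy.le)⟩
  refine ⟨.ofLacunary (fun x => dist x o) (fun x y => abs_dist_sub_le x y o) z (fun _ => o) 1 hz0
    (fun m n hmn => ?_) (fun m n => Or.inr ?_) fun n => by rw [one_mul]⟩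
  · rcases hmn.lt_or_gt with h | h
    · exact Or.inl (hz m n h)
    · exact Or.inr (hz n m h)
  · simp

/-- Let `ρ x` be the limit of the distances from `x` along a free ultrafilter. Either `ρ` takes
arbitrarily small positive values, which yields a lacunary sequence, or `ρ` is bounded below and a
uniformly separated sequence exists. -/
theorem DisjointBalls.nonempty_of_bounded {M : Type*} [MetricSpace M] [Infinite M] {R : ℝ}
    (hR : ∀ x y : M, dist x y ≤ R) : Nonempty (DisjointBalls M) := by
  set U : Ultrafilter M := hyperfilter M
  have hlim (x : M) : ∃ c, Tendsto (fun z => dist x z) U (𝓝 c) := by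
    obtain ⟨c, -, hc⟩ := isCompact_Icc.ultrafilter_le_nhds (U.map fun z => dist x z)
      (tendsto_principal.2 (Eventually.of_forall fun z =>
        (⟨dist_nonneg, hR x z⟩ : dist x z ∈ Set.Icc 0 R)))
    exact ⟨c, hc⟩
  choose ρ hρ using hlim
  have hρ1 (x y : M) : |ρ x - ρ y| ≤ dist x y :=
    le_of_tendsto' ((hρ x).sub (hρ y)).abs fun z => abs_dist_sub_le x y z
  have hρ2 (x y : M) : dist x y ≤ ρ x + ρ y :=
    ge_of_tendsto' ((hρ x).add (hρ y)) fun z => dist_triangle_right x y z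
  by_cases hc : ∀ c > 0, ∃ x, 0 < ρ x ∧ ρ x < c
  · obtain ⟨z, hz0, hz⟩ := exists_seq_of_forall_finset_exists (fun x : M => 0 < ρ x)
      (fun x y => 4 * ρ y ≤ ρ x) fun s hs => by
        obtain ⟨b, hb0, hb⟩ : ∃ b > 0, ∀ x ∈ s, b ≤ ρ x := by
          rcases s.eq_empty_or_nonempty with rfl | hne
          · exact ⟨1, one_pos, by simp⟩
          · obtain ⟨x, hx, hmin⟩ := s.exists_min_image ρ hne
            exact ⟨ρ x, hs x hx, hmin⟩
        obtain ⟨y, hy0, hy⟩ := hc (b / 4) (by positivity)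
        exact ⟨y, hy0, fun x hx => by linarith [hb x hx]⟩
    have hz' (m n : ℕ) (hmn : m ≠ n) : 4 * ρ (z m) ≤ ρ (z n) ∨ 4 * ρ (z n) ≤ ρ (z m) := by
      rcases hmn.lt_or_gt with h | h
      · exact Or.inr (hz m n h)
      · exact Or.inl (hz n m h)
    -- Even terms are centres and odd terms outer points; `5/4` comes from `dist x y ≤ ρ x + ρ y ≤
    -- (1 + 1/4) ρ x`.
    refine ⟨.ofLacunary ρ hρ1 (fun n => z (2 * n)) (fun n => z (2 * n + 1)) (5 / 4)
      (fun n => hz0 _) (fun m n hmn => hz' _ _ (by omega)) (fun m n => hz' _ _ (by omega))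
      fun n => ?_⟩
    linarith [hρ2 (z (2 * n)) (z (2 * n + 1)), hz (2 * n) (2 * n + 1) (by omega)]
  · push Not at hc
    obtain ⟨c, hc0, hc⟩ := hc
    have hρc (x : M) : c ≤ ρ x := by
      -- If `ρ x = 0`, the ultrafilter converges to `x`, and a nearby `z ≠ x` has `0 < dist x z ≤ ρ
      -- z < c`, against the choice of `c`.
      refine hc x ((ge_of_tendsto' (hρ x) fun z => dist_nonneg).lt_of_ne' fun h0 => ?_)
      have h1 : ∀ᶠ z in (U : Filter M), dist x z < c := (hρ x).eventually_lt_const (h0 ▸ hc0)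
      have h2 : ∀ᶠ z in (U : Filter M), z ≠ x :=
        hyperfilter_le_cofinite (Set.finite_singleton x).compl_mem_cofinite
      obtain ⟨z, hz1, hz2⟩ := (h1.and h2).exists
      have hz3 := dist_pos.2 hz2.symm
      have h3 := hρ2 x z
      obtain ⟨h4, -⟩ := abs_le.1 (hρ1 x z)
      linarith [hc z (by linarith)]
    obtain ⟨z, -, hz⟩ := exists_seq_of_forall_finset_exists (fun _ : M => True)
      (fun x y => c / 2 ≤ dist x y) fun s _ => by
        have h : ∀ᶠ y in (U : Filter M), ∀ x ∈ s, c / 2 ≤ dist x y :=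
          (Finset.eventually_all s).2 fun x _ =>
            (hρ x).eventually_const_le (by linarith [hρc x])
        exact h.exists.imp fun y hy => ⟨trivial, hy⟩
    exact ⟨{
      center := fun n => z (n + 1)
      outer := fun _ => z 0
      radius := fun _ => c / 4
      ratio := R / (c / 4)
      radius_pos := fun _ => by positivity
      add_radius_le := fun m n hmn => by
        rcases hmn.lt_or_gt with h | h
        · linarith [hz (m + 1) (n + 1) (by omega)]
        · rw [dist_comm]
          linarith [hz (n + 1) (m + 1) (by omega)]
      radius_le := fun m n => by linarith [hz 0 (n + 1) (by omega)]
      dist_le := fun n => by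
        rw [div_mul_cancel₀ _ (by positivity)]
        exact hR _ _ }⟩

theorem DisjointBalls.nonempty (M : Type*) [MetricSpace M] [Infinite M] (o : M) :
    Nonempty (DisjointBalls M) := by
  by_cases h : ∀ R : ℝ, ∃ x, R < dist x o
  · exact nonempty_of_unbounded o h
  · push Not at h
    obtain ⟨R, hR⟩ := h
    exact nonempty_of_bounded (R := R + R) fun x y =>
      (dist_triangle_right x y o).trans (add_le_add (hR x) (hR y))

/-! ## The `ℓ₁`-system of a Lipschitz-free space -/

namespace LipZero

variable {M : Type u} [MetricSpace M] {o : M}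

theorem delta_apply (x : M) (f : LipZero M o) : delta o x f = f x := rfl

theorem norm_delta_sub_le (x y : M) : ‖delta o x - delta o y‖ ≤ dist x y :=
  ContinuousLinearMap.opNorm_le_bound _ dist_nonneg fun f => by
    rw [mul_comm]
    exact f.abs_sub_le x y

/-- A Lipschitz function, shifted to vanish at the base point. -/
def ofLipschitz (o : M) (f : M → ℝ) (K : ℝ≥0) (hf : LipschitzWith K f) : LipZero M o :=
  ⟨fun x => f x - f o, sub_self _, K, LipschitzWith.of_dist_le_mul fun x y => by
    rw [dist_sub_right]
    exact hf.dist_le_mul x y⟩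

theorem ofLipschitz_sub (f : M → ℝ) (K : ℝ≥0) (hf : LipschitzWith K f) (x y : M) :
    ofLipschitz o f K hf x - ofLipschitz o f K hf y = f x - f y :=
  sub_sub_sub_cancel_right _ _ _

end LipZero

namespace DisjointBalls

variable {M : Type u} [MetricSpace M] (B : DisjointBalls M)

/-- The distance to the complement of the `n`-th ball, measured along radii. -/
def bump (n : ℕ) (x : M) : ℝ := max 0 (B.radius n - dist x (B.center n))

theorem lipschitzWith_bump (n : ℕ) : LipschitzWith 1 (B.bump n) := by
  refine LipschitzWith.of_dist_le_mul fun x y => ?_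
  rw [NNReal.coe_one, one_mul, Real.dist_eq, bump, bump, max_comm 0, max_comm 0]
  refine (abs_max_sub_max_le_abs _ _ _).trans ?_
  rw [sub_sub_sub_cancel_left, abs_sub_comm]
  exact abs_dist_sub_le x y _

theorem bump_eq_zero {n : ℕ} {x : M} (h : B.radius n ≤ dist x (B.center n)) : B.bump n x = 0 :=
  max_eq_left (sub_nonpos.2 h)

theorem bump_center (m n : ℕ) : B.bump m (B.center n) = if m = n then B.radius n else 0 := by
  split_ifs with h
  · subst h
    simp [bump, (B.radius_pos m).le]
  · exact B.bump_eq_zero (by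
      rw [dist_comm]
      linarith [B.add_radius_le m n h, B.radius_pos n])

theorem card_filter_bump_ne_zero_le (s : Finset ℕ) (x : M) :
    (s.filter fun n => B.bump n x ≠ 0).card ≤ 1 := by
  refine Finset.card_le_one.2 fun m hm n hn => by_contra fun hmn => ?_
  have h1 : dist x (B.center m) < B.radius m :=
    not_le.1 fun h => (Finset.mem_filter.1 hm).2 (B.bump_eq_zero h)
  have h2 : dist x (B.center n) < B.radius n :=
    not_le.1 fun h => (Finset.mem_filter.1 hn).2 (B.bump_eq_zero h)
  linarith [B.add_radius_le m n hmn, dist_triangle_left (B.center m) (B.center n) x]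

/-- Only the ball containing `x` and the one containing `y` contribute, and each tent is
1-Lipschitz. -/
theorem sum_abs_bump_sub_le (s : Finset ℕ) (x y : M) :
    ∑ n ∈ s, |B.bump n x - B.bump n y| ≤ 2 * dist x y := by
  set t := (s.filter fun n => B.bump n x ≠ 0) ∪ s.filter fun n => B.bump n y ≠ 0 with ht
  have hts : t ⊆ s := Finset.union_subset (Finset.filter_subset _ _) (Finset.filter_subset _ _)
  rw [← Finset.sum_subset hts fun n hn hnt => ?_]
  · have h1 : ∑ n ∈ t, |B.bump n x - B.bump n y| ≤ t.card • dist x y :=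
      Finset.sum_le_card_nsmul _ _ _ fun n _ => by
        simpa [Real.dist_eq] using (B.lipschitzWith_bump n).dist_le_mul x y
    have h2 : t.card ≤ 2 := (Finset.card_union_le _ _).trans
      (add_le_add (B.card_filter_bump_ne_zero_le s x) (B.card_filter_bump_ne_zero_le s y))
    rw [nsmul_eq_mul] at h1
    exact h1.trans (mul_le_mul_of_nonneg_right (by exact_mod_cast h2) dist_nonneg)
  · simp only [ht, Finset.mem_union, Finset.mem_filter, hn, true_and, not_or, not_not] at hnt
    rw [hnt.1, hnt.2, sub_zero, abs_zero]

end DisjointBalls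

namespace LipFree

variable {M : Type u} [MetricSpace M] {o : M}

instance : CompleteSpace (LipFree M o) :=
  (Submodule.isClosed_topologicalClosure
    (Submodule.span ℝ (Set.range (LipZero.delta (M := M) o)))).completeSpace_coe

/-- The inclusion into the dual of `Lip₀(M)`. -/
def incl (M : Type u) [MetricSpace M] (o : M) : LipFree M o →ₗᵢ[ℝ] StrongDual ℝ (LipZero M o) :=
  (lipFree M o).subtypeₗᵢ

/-- The evaluation functional at `x`, as an element of the free space. -/
def delta (o x : M) : LipFree M o :=
  ⟨LipZero.delta o x, Submodule.le_topologicalClosure _ (Submodule.subset_span ⟨x, rfl⟩)⟩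

theorem incl_delta (x : M) : incl M o (delta o x) = LipZero.delta o x := rfl

/-- Lipschitz functions as functionals on the free space. -/
def ofLipZero : LipZero M o →L[ℝ] StrongDual ℝ (LipFree M o) :=
  (incl M o).toContinuousLinearMap.flip

theorem ofLipZero_apply (f : LipZero M o) (μ : LipFree M o) : ofLipZero f μ = incl M o μ f := rfl

theorem norm_ofLipZero_le (f : LipZero M o) : ‖ofLipZero f‖ ≤ ‖f‖ :=
  ContinuousLinearMap.opNorm_le_bound _ (norm_nonneg f) fun μ => by
    rw [mul_comm, ← (incl M o).norm_map μ]
    exact (incl M o μ).le_opNorm f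

/-- The free space over an infinite metric space has an `ℓ₁`-system of molecules. -/
def ellOneSystem (B : DisjointBalls M) : EllOneSystem (LipFree M o) where
  vec n := (B.radius n)⁻¹ • (delta o (B.center n) - delta o (B.outer n))
  dual n := ofLipZero (LipZero.ofLipschitz o (B.bump n) 1 (B.lipschitzWith_bump n))
  -- The maximum with 1 supplies positivity.
  vecBound := max B.ratio 1
  dualBound := 2
  vecBound_pos := lt_max_of_lt_right one_pos
  norm_vec_le n := by
    rw [norm_smul, norm_inv, Real.norm_of_nonneg (B.radius_pos n).le,
      inv_mul_le_iff₀ (B.radius_pos n), ← (incl M o).norm_map, map_sub, mul_comm]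
    exact (LipZero.norm_delta_sub_le _ _).trans ((B.dist_le n).trans
      (mul_le_mul_of_nonneg_right (le_max_left _ _) (B.radius_pos n).le))
  dual_vec m n := by
    have h : LipZero.ofLipschitz o (B.bump m) 1 (B.lipschitzWith_bump m) (B.center n) -
        LipZero.ofLipschitz o (B.bump m) 1 (B.lipschitzWith_bump m) (B.outer n) =
        if m = n then B.radius n else 0 := by
      rw [LipZero.ofLipschitz_sub, B.bump_eq_zero (B.radius_le n m), sub_zero, B.bump_center]
    rw [map_smul, map_sub, ofLipZero_apply, ofLipZero_apply, incl_delta, incl_delta,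
      LipZero.delta_apply, LipZero.delta_apply, h, smul_eq_mul]
    split_ifs
    · exact inv_mul_cancel₀ (B.radius_pos n).ne'
    · exact mul_zero _
  norm_signedSum_le s t := by
    rw [← map_signedSum ofLipZero]
    refine (norm_ofLipZero_le _).trans (LipZero.norm_le zero_le_two fun x y => ?_)
    rw [← LipZero.delta_apply x, ← LipZero.delta_apply y, ← sub_apply,
      map_signedSum]
    refine (Finset.abs_sum_le_sum_abs _ _).trans
      (le_trans (Finset.sum_le_sum fun n _ => le_of_eq ?_) (B.sum_abs_bump_sub_le s x y))
    have e : (LipZero.delta o x - LipZero.delta o y)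
        (LipZero.ofLipschitz o (B.bump n) 1 (B.lipschitzWith_bump n)) =
        B.bump n x - B.bump n y := LipZero.ofLipschitz_sub _ 1 (B.lipschitzWith_bump n) _ _
    simp only [e]
    split_ifs
    · rfl
    · rw [abs_neg]

/-- The map `x ↦ δ x` is 1-Lipschitz, and separability passes to closed spans. -/
theorem separableSpace [TopologicalSpace.SeparableSpace M] :
    TopologicalSpace.SeparableSpace (LipFree M o) := by
  have hc : Continuous (LipZero.delta (M := M) o) :=
    (LipschitzWith.of_dist_le_mul (K := 1) fun x y => by
      rw [dist_eq_norm, NNReal.coe_one, one_mul]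
      exact LipZero.norm_delta_sub_le x y).continuous
  have h : TopologicalSpace.IsSeparable
      (lipFree M o : Set (StrongDual ℝ (LipZero M o))) :=
    (TopologicalSpace.isSeparable_range hc).span.closure
  exact h.separableSpace

end LipFree

end

theorem theorem1 (M : Type u) [MetricSpace M] [Infinite M] (o : M) :
    -- there is a complemented subspace isomorphic to `ℓ₁`
    HasComplementedCopy (LipFree M o) EllOne ∧
    -- not isomorphic to a complemented subspace of any `C(K)`
    (∀ (K : Type v) [TopologicalSpace K] [CompactSpace K] [T2Space K],
      ¬ HasComplementedCopy C(K, ℝ) (LipFree M o)) ∧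
    -- the dual is not weakly sequentially complete; not isomorphic to an `L¹`-predual
    ¬ IsWeaklySequentiallyComplete (StrongDual ℝ (LipFree M o)) ∧
    (∀ (Z : Type v) [NormedAddCommGroup Z] [NormedSpace ℝ Z] [CompleteSpace Z],
      IsLOnePredual.{v, w} Z → ¬ Nonempty (LipFree M o ≃L[ℝ] Z)) ∧
    -- not isomorphic to the Gurariĭ space
    (∀ (G : Type v) [NormedAddCommGroup G] [NormedSpace ℝ G],
      IsGurariiSpace G → ¬ Nonempty (LipFree M o ≃L[ℝ] G)) ∧
    -- every separable Banach space is a quotient; separable if `M` is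
    (∀ (Y : Type v) [NormedAddCommGroup Y] [NormedSpace ℝ Y] [CompleteSpace Y]
      [TopologicalSpace.SeparableSpace Y], ∃ T : LipFree M o →L[ℝ] Y, Function.Surjective T) ∧
    (TopologicalSpace.SeparableSpace M → TopologicalSpace.SeparableSpace (LipFree M o)) := by
  obtain ⟨B⟩ := DisjointBalls.nonempty M o
  let S : EllOneSystem (LipFree M o) := LipFree.ellOneSystem B
  refine ⟨S.hasComplementedCopy, ?_, S.not_isWeaklySequentiallyComplete, ?_, ?_, ?_, ?_⟩
  · rintro K _ _ _ ⟨V, ⟨P, hP⟩, ⟨e⟩⟩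
    -- The projection onto `V` followed by `e.symm` is a left inverse of the embedding.
    exact (S.transport (V.subtypeL.comp e.toContinuousLinearMap)
      (e.symm.toContinuousLinearMap.comp P) fun x => by simp [hP]).not_continuousMap
  · rintro Z _ _ _ ⟨Ω, _, μ, ⟨U⟩⟩ ⟨e⟩
    exact (S.transport e.toContinuousLinearMap e.symm.toContinuousLinearMap
      e.symm_apply_apply).not_dual_isometric_lp_one U
  · rintro G _ _ hG ⟨e⟩
    exact (S.transport e.toContinuousLinearMap e.symm.toContinuousLinearMap
      e.symm_apply_apply).not_isGurariiSpace hG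
  · intro Y _ _ _ _
    obtain ⟨T, hT⟩ := EllOne.exists_surjective Y
    exact ⟨T.comp S.toEllOne, hT.comp S.surjective_toEllOne⟩
  · intro _
    exact LipFree.separableSpace
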